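/- **Operators.** Let $\Lambda^-=\mathbb C[p_1,p_3,p_5,\dots]$ be the ring generated by the odd power sums, and define operators $Y_n$ ($n\in\mathbb Z$) on $\Lambda^-$ by $$Y(t)=\sum_{n\in\mathbb Z}Y_nt^{-n}=\exp\Big(\sum_{k\ge1}\frac{2\,t^{2k-1}}{2k-1}\,p_{2k-1}\Big)\exp\Big(-\sum_{k\ge1}t^{-(2k-1)}\frac{\partial}{\partial p_{2k-1}}\Big).$$ For a finite sequence of integers $\mu=(\mu_1,\dots,\mu_l)$ put $Y_{-\mu}=Y_{-\mu_1}Y_{-\mu_2}\cdots Y_{-\mu_l}$. We say that $\mu$ is a composition of $m$ if $\mu_1+\cdots+\mu_l=m$ (zero or negative parts are allowed). **Shifted codes.** For $d\in\mathbb Z$ let $H(d)$ be the word $R^d$ if $d\ge0$ and $L^{-d}$ if $d<0$. The shifted code of $\mu$ is the infinite word $$H(\mu_l-1)\,U\,H(\mu_{l-1}-\mu_l-1)\,U\cdots H(\mu_1-\mu_2-1)\,U\,RRR\cdots$$ in the letters $R,L,U$ (it is $RRR\cdots$ for $l=0$). For positive parts it traces, by unit steps right, left and up, the right edge of the shifted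 Young diagram of $\mu$, starting at the bottom right corner of the leftmost box of the bottom row, and then the positive $x$-axis. A word is said to give the shifted code of $\nu$ if it is equal to it up to finitely many insertions and deletions of adjacent pairs $LR$ and $RL$. **Theorem.** Let $\mu$ be a composition of $m$ whose shifted code can be written as $$\alpha=\beta_t\cdots\beta_3\beta_2\beta_1\,L^k\,U\,\gamma_1\gamma_2\gamma_3\cdots,\qquad k\ge1,$$ where $\beta_t,\dots,\beta_1$ are all $R$'s or $U$'s and $\beta_1=U$. If all parts of $\mu$ are positive, then $k\le t$, so that $\beta_k$ exists. Whenever $k\le t$: * If $\beta_k=U$, then $Y_{-\mu}=0$. * If $\beta_k=R$, then the word $$\beta_t\cdots\beta_{k+1}\,U\,\beta_{k-1}\cdots\beta_2\beta_1\,L^{k-1}\,\gamma_1\gamma_2\gamma_3\cdots$$ gives the shifted code of exactly one finite sequence of integers $\nu$; this $\nu$ is a composition of $m$, its parts are nonnegative (respectively positive) if those of $\mu$ are, and $$Y_{-\mu}=(-1)^jY_{-\nu},$$ where $j$ is the number of $U$'s in $\beta_{k-1}\cdots\beta_2\beta_1$. -/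

import Mathlib

open scoped PowerSeries Nat

namespace ShiftedCode

noncomputable section

/-! ### The operators `Y_n` on the ring generated by the odd power sums -/

/-- The ring `Λ⁻ = ℂ[p₁, p₃, p₅, …]`; the variable with index `n` is the odd power sum `p_n`. -/
abbrev OddPowerSumRing : Type := MvPolynomial {n : ℕ // Odd n} ℂ

/-- The exponential `∑ F ^ r / r!` of a formal power series `F` with zero constant term (over a
possibly noncommutative algebra). As `X ^ r` divides `F ^ r`, only the `r ≤ a` contribute to the
coefficient of `X ^ a`. -/
def formalExp {A : Type*} [Ring A] [Algebra ℂ A] (F : A⟦X⟧) : A⟦X⟧ :=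
  PowerSeries.mk fun a => ∑ r ∈ Finset.range (a + 1), ((r ! : ℂ)⁻¹) • PowerSeries.coeff a (F ^ r)

/-- The series `∑ (2 / n) p_n t ^ n`, summed over the odd `n`. -/
def creationExponent : OddPowerSumRing⟦X⟧ :=
  PowerSeries.mk fun n =>
    if h : Odd n then MvPolynomial.C (2 / (n : ℂ)) * MvPolynomial.X ⟨n, h⟩ else 0

/-- The series `-∑ (∂ / ∂p_n) s ^ n`, summed over the odd `n`, where `s` stands for `t⁻¹`. -/
def annihilationExponent : (Module.End ℂ OddPowerSumRing)⟦X⟧ :=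
  PowerSeries.mk fun n =>
    if h : Odd n then -(MvPolynomial.pderiv (R := ℂ) (⟨n, h⟩ : {n : ℕ // Odd n})).toLinearMap
    else 0

/-- The coefficient of `t ^ a` in `exp (∑ (2 / n) p_n t ^ n)`; it is zero for `a < 0`. -/
def creationCoeff (a : ℤ) : OddPowerSumRing :=
  if 0 ≤ a then PowerSeries.coeff a.toNat (formalExp creationExponent) else 0

/-- The coefficient of `t ^ (-b)` in `exp (-∑ t ^ (-n) ∂ / ∂p_n)`. -/
def annihilationCoeff (b : ℕ) : Module.End ℂ OddPowerSumRing :=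
  PowerSeries.coeff b (formalExp annihilationExponent)

/-- The weight of the variable `p_n` is `n`. -/
def weight (n : {n : ℕ // Odd n}) : ℤ := (n.1 : ℤ)

/-- `T` lowers the weighted degree by `b`. -/
def Lowers (b : ℕ) (T : Module.End ℂ OddPowerSumRing) : Prop :=
  ∀ (d : ℤ) (f : OddPowerSumRing), f.IsWeightedHomogeneous weight d →
    (T f).IsWeightedHomogeneous weight (d - b)

theorem Lowers.sum {ι : Type*} {b : ℕ} (s : Finset ι) {T : ι → Module.End ℂ OddPowerSumRing}
    (h : ∀ i ∈ s, Lowers b (T i)) : Lowers b (∑ i ∈ s, T i) := by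
  intro d f hf
  rw [LinearMap.sum_apply]
  exact Submodule.sum_mem (MvPolynomial.weightedHomogeneousSubmodule ℂ weight (d - b))
    fun i hi => h i hi d f hf

theorem Lowers.smul {b : ℕ} {T : Module.End ℂ OddPowerSumRing} (c : ℂ) (h : Lowers b T) :
    Lowers b (c • T) := fun d f hf =>
  Submodule.smul_mem (MvPolynomial.weightedHomogeneousSubmodule ℂ weight (d - b)) c (h d f hf)

theorem lowers_annihilationExponent (b : ℕ) :
    Lowers b (PowerSeries.coeff b annihilationExponent) := by
  intro d f hf
  rw [annihilationExponent, PowerSeries.coeff_mk]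
  split_ifs with h
  · have := MvPolynomial.IsWeightedHomogeneous.pderiv (n' := d - b) (i := ⟨b, h⟩) hf
      (by simp [weight])
    exact Submodule.neg_mem (MvPolynomial.weightedHomogeneousSubmodule ℂ weight (d - b)) this
  · exact MvPolynomial.isWeightedHomogeneous_zero _ _ _

theorem lowers_annihilationExponent_pow (r b : ℕ) :
    Lowers b (PowerSeries.coeff b (annihilationExponent ^ r)) := by
  induction r generalizing b with
  | zero =>
    intro d f hf
    rw [pow_zero, PowerSeries.coeff_one]
    split_ifs with h
    · simpa [h] using hf
    · exact MvPolynomial.isWeightedHomogeneous_zero _ _ _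
  | succ r ih =>
    rw [pow_succ, PowerSeries.coeff_mul]
    refine Lowers.sum _ fun x hx d f hf => ?_
    have h1 := ih x.1 _ _ (lowers_annihilationExponent x.2 d f hf)
    have hx' : x.1 + x.2 = b := by simpa using hx
    have h2 : d - (x.2 : ℤ) - (x.1 : ℤ) = d - (b : ℤ) := by omega
    rw [h2] at h1
    exact h1

theorem lowers_annihilationCoeff (b : ℕ) : Lowers b (annihilationCoeff b) := by
  rw [annihilationCoeff, formalExp, PowerSeries.coeff_mk]
  exact Lowers.sum _ fun r _ => (lowers_annihilationExponent_pow r b).smul _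

theorem eq_zero_of_weight_neg {d : ℤ} (hd : d < 0) {f : OddPowerSumRing}
    (hf : f.IsWeightedHomogeneous weight d) : f = 0 := by
  ext s
  by_contra hs
  have h := hf (d := s) (by simpa using hs)
  have : 0 ≤ Finsupp.weight weight s := by
    rw [Finsupp.weight_apply]
    exact Finset.sum_nonneg fun i _ => by simp only [weight, nsmul_eq_mul]; positivity
  omega

theorem annihilationCoeff_eventually_zero (f : OddPowerSumRing) :
    ∃ N : ℕ, ∀ b, N ≤ b → annihilationCoeff b f = 0 := by
  induction f using MvPolynomial.induction_on' with
  | monomial s a =>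
    refine ⟨(Finsupp.weight weight s).toNat + 1, fun b hb => ?_⟩
    refine eq_zero_of_weight_neg (d := Finsupp.weight weight s - b) (by omega)
      (lowers_annihilationCoeff b _ _ ?_)
    exact MvPolynomial.isWeightedHomogeneous_monomial _ _ _ rfl
  | add p q hp hq =>
    obtain ⟨M, hM⟩ := hp
    obtain ⟨N, hN⟩ := hq
    refine ⟨max M N, fun b hb => ?_⟩
    rw [map_add, hM b (le_of_max_le_left hb), hN b (le_of_max_le_right hb), add_zero]

theorem finite_support (n : ℤ) (f : OddPowerSumRing) :
    (Function.support fun b : ℕ => creationCoeff (b - n) * annihilationCoeff b f).Finite := by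
  obtain ⟨N, hN⟩ := annihilationCoeff_eventually_zero f
  refine (Set.finite_Iio N).subset fun b hb => ?_
  by_contra h
  exact hb (by simp [hN b (by simpa using h)])

/-- The operator `Y_n`, for `n : ℤ`: the coefficient of `t ^ (-n)` in
`Y(t) = ∑ Y_n t ^ (-n)
  = exp (∑ (2 / r) t ^ r p_r) * exp (-∑ t ^ (-r) ∂ / ∂p_r)` (sums over the odd `r`).
The sum collects the products of the coefficients of `t ^ (b - n)` and `t ^ (-b)`; applied to any
fixed element it is finite. -/
def Y (n : ℤ) : Module.End ℂ OddPowerSumRing where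
  toFun f := ∑ᶠ b : ℕ, creationCoeff (b - n) * annihilationCoeff b f
  map_add' f g := by
    rw [← finsum_add_distrib (finite_support n f) (finite_support n g)]
    simp only [map_add, mul_add]
  map_smul' c f := by
    rw [RingHom.id_apply, smul_finsum' c (finite_support n f)]
    simp only [map_smul, mul_smul_comm]

/-- `Y_{-μ} = Y_{-μ₁} Y_{-μ₂} ⋯ Y_{-μ_l}`. -/
def YNeg (μ : List ℤ) : Module.End ℂ OddPowerSumRing :=
  (μ.map fun a => Y (-a)).prod

end

/-! ### Shifted codes -/

/-- The letters of a code: a unit step right, left or up. -/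
inductive Letter : Type
  | R
  | L
  | U
  deriving DecidableEq

open Letter

/-- The reduced word of a horizontal displacement by `d`. -/
def horizontal (d : ℤ) : List Letter :=
  if 0 ≤ d then List.replicate d.toNat R else List.replicate (-d).toNat L

/-- The path, read from the bottom to the top, along the right edge of the shifted diagram of
`μ = [μ₁, …, μ_l]`. The right edge of row `i` (from the top) has abscissa `i - 1 + μ_i`, and the
path starts at abscissa `l` on the bottom line. So it moves horizontally by `μ_l - 1` and goes up,
and to pass from row `i + 1` to row `i` it moves by `μ_i - μ_{i+1} - 1` before it goes up. -/
def shiftedPath : List ℤ → List Letter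
  | [] => []
  | [a] => horizontal (a - 1) ++ [U]
  | a :: b :: r => shiftedPath (b :: r) ++ horizontal (a - b - 1) ++ [U]

/-- The shifted code of `μ`: the path above, followed by the positive `x`-axis `RRR…`. -/
def shiftedCode (μ : List ℤ) : Stream' Letter :=
  shiftedPath μ ++ₛ Stream'.const R

/-- Deletion of one adjacent pair `LR` or `RL`. -/
def CancelStep (v w : Stream' Letter) : Prop :=
  ∃ (u : List Letter) (x : Stream' Letter),
    (v = (u ++ [L, R]) ++ₛ x ∨ v = (u ++ [R, L]) ++ₛ x) ∧ w = u ++ₛ x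

/-- Two infinite words are equal up to finitely many insertions and deletions of adjacent pairs
`LR` and `RL`. -/
def CancelEquiv : Stream' Letter → Stream' Letter → Prop :=
  Relation.EqvGen CancelStep

end ShiftedCode

open ShiftedCode ShiftedCode.Letter

/-! Give a point of the lattice path the content `x + y`, measured from the start of the path: `R`
and `U` raise it by one, `L` lowers it by one. The parts of `μ`, from last to first, are the
contents reached by the letters `U`. The word `β_t ⋯ β_1` climbs to content `t`, so the `U` after
`L^k` produces the part `a = t - k + 1`, while a letter `β_i = U` produces the part `t - i + 1`.
Hence `a` stands immediately before the positive parts coming from `β_1, β_2, …`, and its own value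
belongs to the position `β_k`.

The rest is one algebraic fact: `Y_{-a}` and `Y_{-c}` anticommute for positive `a`, `c`
(`Y_neg_anticomm`), so that `Y_{-a}` squares to zero. Moving `Y_{-a}` to its place costs a sign for
every `U` among `β_1, …, β_{k-1}`. If `β_k = U`, it meets its twin and the product vanishes. If `β_k
= R`, the result is `Y_{-ν}`, where `β_k` has become `U`. Deleting `L` and `U` together keeps the
displacement, so the parts coming from `γ` are unchanged.

For the anticommutation, let `Q(t) = ∑ q_n t^n` be the first factor of `Y(t)`. Moving the second
factor of `Y(s)` past `Q(t)` multiplies by `(1 - x) / (1 + x)` with `x = t / s`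
(`annihilationCoeff_creationCoeff`, `annihilationCoeff_mul`). In the normally ordered product, the
symmetrised coefficients are multiples of coefficients of `Q(t) Q(-t) = 1` of positive degree
(`contraction_add_comm`). All these identities of exponentials come from the differential equation
`euler_formalExp`, used as a recursion.

Uniqueness of `ν` holds because cancelling `LR` or `RL` does not change contents
(`CancelEquiv.hasContents_iff`); existence, because every finite word reduces to the path of its
contents (`cancelEquiv_shiftedPath_append`). -/

namespace ShiftedCode

/-! ### Formal exponentials and their differential equation -/

section FormalExp

variable {A : Type*} [Ring A]

/-- The Euler operator `X d/dX` on power series over a possibly noncommutative ring. -/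
noncomputable def euler (F : A⟦X⟧) : A⟦X⟧ :=
  PowerSeries.mk fun n => n • PowerSeries.coeff n F

@[simp]
theorem coeff_euler (n : ℕ) (F : A⟦X⟧) :
    PowerSeries.coeff n (euler F) = n • PowerSeries.coeff n F :=
  PowerSeries.coeff_mk _ _

theorem euler_one : euler (1 : A⟦X⟧) = 0 := by
  ext n
  rw [coeff_euler, PowerSeries.coeff_one]
  split_ifs with h <;> simp [h]

theorem euler_mul (F G : A⟦X⟧) : euler (F * G) = euler F * G + F * euler G := by
  ext n
  rw [coeff_euler, map_add, PowerSeries.coeff_mul, PowerSeries.coeff_mul, PowerSeries.coeff_mul,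
    Finset.smul_sum, ← Finset.sum_add_distrib]
  refine Finset.sum_congr rfl fun p hp => ?_
  rw [coeff_euler, coeff_euler, smul_mul_assoc, mul_smul_comm, ← add_smul,
    Finset.HasAntidiagonal.mem_antidiagonal.1 hp]

theorem euler_pow_succ {F : A⟦X⟧} (h : Commute F (euler F)) (r : ℕ) :
    euler (F ^ (r + 1)) = (r + 1) • (euler F * F ^ r) := by
  induction r with
  | zero => simp
  | succ r ih =>
    rw [pow_succ, euler_mul, ih, (h.pow_left (r + 1)).eq, smul_mul_assoc, mul_assoc, ← pow_succ,
      succ_nsmul _ (r + 1)]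

theorem coeff_pow_eq_zero {F : A⟦X⟧} (hF : PowerSeries.coeff 0 F = 0) {n r : ℕ} (h : n < r) :
    PowerSeries.coeff n (F ^ r) = 0 := by
  induction r generalizing n with
  | zero => omega
  | succ r ih =>
    rw [pow_succ, PowerSeries.coeff_mul]
    refine Finset.sum_eq_zero fun p hp => ?_
    have hp' := Finset.HasAntidiagonal.mem_antidiagonal.1 hp
    rcases Nat.eq_zero_or_pos p.2 with h0 | h0
    · rw [h0, hF, mul_zero]
    · rw [ih (by omega), zero_mul]

theorem commute_of_coeff {F G : A⟦X⟧}
    (h : ∀ i j, Commute (PowerSeries.coeff i F) (PowerSeries.coeff j G)) : Commute F G := by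
  ext n
  rw [PowerSeries.coeff_mul, PowerSeries.coeff_mul, ← Finset.Nat.sum_antidiagonal_swap]
  exact Finset.sum_congr rfl fun p _ => h _ _

theorem Commute.coeff_pow {x : A} {F : A⟦X⟧} (h : ∀ i, Commute x (PowerSeries.coeff i F))
    (r n : ℕ) : Commute x (PowerSeries.coeff n (F ^ r)) := by
  induction r generalizing n with
  | zero =>
    rw [pow_zero, PowerSeries.coeff_one]
    split_ifs
    · exact Commute.one_right x
    · exact Commute.zero_right x
  | succ r ih =>
    rw [pow_succ, PowerSeries.coeff_mul]
    exact Commute.sum_right _ _ _ fun p _ => (ih _).mul_right (h _)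

variable [Algebra ℂ A]

theorem coeff_formalExp (F : A⟦X⟧) (n : ℕ) :
    PowerSeries.coeff n (formalExp F) =
      ∑ r ∈ Finset.range (n + 1), ((r ! : ℂ)⁻¹) • PowerSeries.coeff n (F ^ r) :=
  PowerSeries.coeff_mk _ _

theorem coeff_zero_formalExp (F : A⟦X⟧) : PowerSeries.coeff 0 (formalExp F) = 1 := by
  simp [coeff_formalExp]

theorem coeff_formalExp_of_lt {F : A⟦X⟧} (hF : PowerSeries.coeff 0 F = 0) {n M : ℕ} (h : n < M) :
    PowerSeries.coeff n (formalExp F) =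
      ∑ r ∈ Finset.range M, ((r ! : ℂ)⁻¹) • PowerSeries.coeff n (F ^ r) := by
  rw [coeff_formalExp]
  refine Finset.sum_subset (Finset.range_subset_range.2 h) fun r _ hr => ?_
  rw [coeff_pow_eq_zero hF (by simpa using hr), smul_zero]

theorem Commute.coeff_formalExp {x : A} {F : A⟦X⟧} (h : ∀ i, Commute x (PowerSeries.coeff i F))
    (n : ℕ) : Commute x (PowerSeries.coeff n (formalExp F)) := by
  rw [ShiftedCode.coeff_formalExp]
  exact Commute.sum_right _ _ _ fun r _ => (Commute.coeff_pow h r n).smul_right _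

/-- The differential equation of the exponential of a series with commuting coefficients. -/
theorem euler_formalExp {F : A⟦X⟧} (hF : PowerSeries.coeff 0 F = 0)
    (hc : ∀ i j, Commute (PowerSeries.coeff i F) (PowerSeries.coeff j F)) :
    euler (formalExp F) = euler F * formalExp F := by
  have hFe : Commute F (euler F) := commute_of_coeff fun i j => by
    rw [coeff_euler]
    exact (hc i j).smul_right j
  ext a
  have key (r : ℕ) : a • (((r + 1)! : ℂ)⁻¹ • PowerSeries.coeff a (F ^ (r + 1))) =
      ((r ! : ℂ)⁻¹) • PowerSeries.coeff a (euler F * F ^ r) := by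
    rw [smul_comm, ← coeff_euler, euler_pow_succ hFe, map_nsmul, ← Nat.cast_smul_eq_nsmul ℂ,
      smul_smul, Nat.factorial_succ]
    congr 1
    have : ((r : ℂ) + 1) ≠ 0 := Nat.cast_add_one_ne_zero r
    have : (r ! : ℂ) ≠ 0 := Nat.cast_ne_zero.2 r.factorial_ne_zero
    push_cast
    field_simp
  have h0 : a • PowerSeries.coeff a (F ^ 0) = 0 := by
    rw [pow_zero, ← coeff_euler, euler_one, map_zero]
  -- With the bound `a + 2`, dropping the term `r = 0` leaves the range `a + 1`, which also suffices
  -- for every factor on the right-hand side.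
  rw [coeff_euler, coeff_formalExp_of_lt hF (show a < a + 2 by omega), Finset.sum_range_succ',
    smul_add, smul_comm a, h0, smul_zero, add_zero, Finset.smul_sum, PowerSeries.coeff_mul]
  simp_rw [key, PowerSeries.coeff_mul, Finset.smul_sum]
  rw [Finset.sum_comm]
  refine Finset.sum_congr rfl fun p hp => ?_
  have hp' := Finset.HasAntidiagonal.mem_antidiagonal.1 hp
  rw [coeff_formalExp_of_lt hF (show p.2 < a + 1 by omega), Finset.mul_sum]
  simp_rw [mul_smul_comm]

end FormalExp

end ShiftedCode

namespace ShiftedCode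

open Finset.HasAntidiagonal

/-! ### Reindexing of triple sums -/

section Antidiagonal

variable {M : Type*} [AddCommMonoid M]

theorem sum_antidiagonal_assoc (n : ℕ) (g : ℕ → ℕ → ℕ → M) :
    ∑ p ∈ antidiagonal n, ∑ q ∈ antidiagonal p.2, g p.1 q.1 q.2 =
      ∑ p ∈ antidiagonal n, ∑ q ∈ antidiagonal p.1, g q.1 q.2 p.2 := by
  rw [Finset.sum_sigma', Finset.sum_sigma']
  refine Finset.sum_nbij' (fun x => ⟨(x.1.1 + x.2.1, x.2.2), (x.1.1, x.2.1)⟩)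
    (fun x => ⟨(x.2.1, x.2.2 + x.1.2), (x.2.2, x.1.2)⟩) ?_ ?_ ?_ ?_ ?_
  all_goals
    rintro ⟨⟨a, b⟩, ⟨c, d⟩⟩ h
    simp only [Finset.mem_sigma, mem_antidiagonal] at h ⊢
  · exact ⟨by omega, trivial⟩
  · exact ⟨by omega, trivial⟩
  · obtain ⟨rfl, rfl⟩ := h
    rfl
  · obtain ⟨rfl, rfl⟩ := h
    rfl

theorem sum_antidiagonal_left_comm (n : ℕ) (g : ℕ → ℕ → ℕ → M) :
    ∑ p ∈ antidiagonal n, ∑ q ∈ antidiagonal p.2, g p.1 q.1 q.2 =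
      ∑ p ∈ antidiagonal n, ∑ q ∈ antidiagonal p.2, g q.1 p.1 q.2 := by
  rw [sum_antidiagonal_assoc, sum_antidiagonal_assoc n fun i j k => g j i k]
  exact Finset.sum_congr rfl fun p _ =>
    (Finset.Nat.sum_antidiagonal_swap (f := fun q => g q.1 q.2 p.2)).symm

end Antidiagonal

/-! ### The annihilation operators -/

theorem coeff_annihilationExponent_zero : PowerSeries.coeff 0 annihilationExponent = 0 := by
  simp [annihilationExponent]

/-- The commutator of two derivations is a derivation, and this one kills the variables. -/
theorem pderiv_comm (i j : {n : ℕ // Odd n}) (f : OddPowerSumRing) :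
    MvPolynomial.pderiv i (MvPolynomial.pderiv j f) =
      MvPolynomial.pderiv j (MvPolynomial.pderiv i f) := by
  have h : ⁅MvPolynomial.pderiv (R := ℂ) i, MvPolynomial.pderiv (R := ℂ) j⁆ = 0 :=
    MvPolynomial.derivation_ext fun k => by
      simp [Derivation.commutator_apply, MvPolynomial.pderiv_X, Pi.single_apply, apply_ite]
  rw [← sub_eq_zero, ← Derivation.commutator_apply, h, Derivation.zero_apply]

theorem commute_annihilationExponent (i j : ℕ) :
    Commute (PowerSeries.coeff i annihilationExponent)
      (PowerSeries.coeff j annihilationExponent) := by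
  simp only [annihilationExponent, PowerSeries.coeff_mk]
  split_ifs with hi hj hj
  · refine LinearMap.ext fun f => ?_
    simp [pderiv_comm ⟨i, hi⟩ ⟨j, hj⟩ f]
  · exact Commute.zero_right _
  · exact Commute.zero_left _
  · exact Commute.zero_left _

theorem commute_annihilationCoeff (i j : ℕ) :
    Commute (annihilationCoeff i) (annihilationCoeff j) :=
  Commute.coeff_formalExp
    (fun k => (Commute.coeff_formalExp (fun l => commute_annihilationExponent k l) i).symm) j

theorem annihilationCoeff_zero : annihilationCoeff 0 = 1 :=
  coeff_zero_formalExp _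

/-- The differential equation read off at degree `n`. The term with `p.1 = 0` vanishes, so for `n >
0` it determines the operator from those of lower index and serves as the recursion in later
inductions. -/
theorem nsmul_annihilationCoeff (n : ℕ) (f : OddPowerSumRing) :
    n • annihilationCoeff n f = ∑ p ∈ antidiagonal n,
      p.1 • PowerSeries.coeff p.1 annihilationExponent (annihilationCoeff p.2 f) := by
  have h := congrArg (PowerSeries.coeff n)
    (euler_formalExp coeff_annihilationExponent_zero commute_annihilationExponent)
  rw [coeff_euler, PowerSeries.coeff_mul] at h
  simpa [annihilationCoeff] using congrArg (fun T => T f) h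

theorem annihilationExponent_mul (k : ℕ) (f g : OddPowerSumRing) :
    PowerSeries.coeff k annihilationExponent (f * g) =
      PowerSeries.coeff k annihilationExponent f * g +
        f * PowerSeries.coeff k annihilationExponent g := by
  simp only [annihilationExponent, PowerSeries.coeff_mk]
  split_ifs with h
  · simp [Derivation.leibniz]
    ring
  · simp

/-- The generating series of the annihilation operators is multiplicative. -/
theorem annihilationCoeff_mul (n : ℕ) (f g : OddPowerSumRing) :
    annihilationCoeff n (f * g) =
      ∑ p ∈ antidiagonal n, annihilationCoeff p.1 f * annihilationCoeff p.2 g := by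
  induction n using Nat.strong_induction_on with
  | _ n ih =>
  rcases Nat.eq_zero_or_pos n with rfl | hn
  · simp [annihilationCoeff_zero]
  -- After multiplication by `n`, both sides expand by the recursion; the exponent acts by
  -- derivations, so its Leibniz rule matches the two halves of `n = p.1 + p.2`.
  refine (smul_right_injective _ hn.ne') ?_
  simp only
  set F : ℕ → Module.End ℂ OddPowerSumRing := fun k => PowerSeries.coeff k annihilationExponent
  have h1 : n • annihilationCoeff n (f * g) = ∑ p ∈ antidiagonal n,
      ∑ q ∈ antidiagonal p.2, p.1 •
        (F p.1 (annihilationCoeff q.1 f) * annihilationCoeff q.2 g +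
          annihilationCoeff q.1 f * F p.1 (annihilationCoeff q.2 g)) := by
    rw [nsmul_annihilationCoeff]
    refine Finset.sum_congr rfl fun p hp => ?_
    have hp' := Finset.HasAntidiagonal.mem_antidiagonal.1 hp
    rcases Nat.eq_zero_or_pos p.1 with h0 | h0
    · simp [h0]
    rw [ih p.2 (by omega), map_sum, Finset.smul_sum]
    exact Finset.sum_congr rfl fun q _ => by rw [annihilationExponent_mul]
  have h2 : n • ∑ p ∈ antidiagonal n, annihilationCoeff p.1 f * annihilationCoeff p.2 g =
      ∑ p ∈ antidiagonal n,
        ((p.1 • annihilationCoeff p.1 f) * annihilationCoeff p.2 g +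
          annihilationCoeff p.1 f * (p.2 • annihilationCoeff p.2 g)) := by
    rw [Finset.smul_sum]
    refine Finset.sum_congr rfl fun p hp => ?_
    rw [smul_mul_assoc, mul_smul_comm, ← add_smul, Finset.HasAntidiagonal.mem_antidiagonal.1 hp]
  rw [h1, h2]
  simp only [smul_add, Finset.sum_add_distrib, nsmul_annihilationCoeff, Finset.sum_mul,
    Finset.mul_sum]
  congr 1
  · rw [sum_antidiagonal_assoc n fun i j k =>
      i • (F i (annihilationCoeff j f) * annihilationCoeff k g)]
    simp only [smul_mul_assoc, F]
  · rw [sum_antidiagonal_left_comm n fun i j k =>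
      i • (annihilationCoeff j f * F i (annihilationCoeff k g))]
    simp only [mul_smul_comm, F]

/-! ### The creation coefficients -/

theorem coeff_creationExponent_zero : PowerSeries.coeff 0 creationExponent = 0 := by
  simp [creationExponent]

theorem euler_formalExp_creationExponent :
    euler (formalExp creationExponent) = euler creationExponent * formalExp creationExponent :=
  euler_formalExp coeff_creationExponent_zero fun _ _ => Commute.all _ _

theorem creationCoeff_natCast (n : ℕ) :
    creationCoeff n = PowerSeries.coeff n (formalExp creationExponent) := by
  simp [creationCoeff]

theorem creationCoeff_of_neg {a : ℤ} (h : a < 0) : creationCoeff a = 0 :=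
  if_neg (by omega)

theorem creationCoeff_zero : creationCoeff 0 = 1 := by
  rw [← Nat.cast_zero, creationCoeff_natCast, coeff_zero_formalExp]

theorem nsmul_creationCoeff (n : ℕ) :
    n • creationCoeff n = ∑ p ∈ antidiagonal n,
      (p.1 • PowerSeries.coeff p.1 creationExponent) * creationCoeff p.2 := by
  have h := congrArg (PowerSeries.coeff n) euler_formalExp_creationExponent
  simpa [PowerSeries.coeff_mul, creationCoeff_natCast] using h

/-- `Q(t) Q(-t) = 1` for the generating series `Q` of the creation coefficients. -/
theorem sum_neg_one_pow_creationCoeff {n : ℕ} (hn : 0 < n) :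
    ∑ p ∈ antidiagonal n,
      (-1) ^ p.1 * (creationCoeff p.1 * creationCoeff p.2) = 0 := by
  set Q := formalExp creationExponent
  set P : OddPowerSumRing⟦X⟧ := PowerSeries.mk fun n => (-1) ^ n * PowerSeries.coeff n Q with hP
  -- `P` is `Q(-t)`. The exponent is odd in `t`, so the logarithmic derivatives of `P` and `Q` are
  -- opposite and `P * Q` is constant.
  have hneg : euler P = -(euler creationExponent * P) := by
    ext1 n
    rw [coeff_euler, hP, PowerSeries.coeff_mk, ← mul_smul_comm, ← coeff_euler,
      euler_formalExp_creationExponent, map_neg, PowerSeries.coeff_mul, PowerSeries.coeff_mul,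
      Finset.mul_sum, ← Finset.sum_neg_distrib]
    refine Finset.sum_congr rfl fun p hp => ?_
    rw [PowerSeries.coeff_mk, ← Finset.HasAntidiagonal.mem_antidiagonal.1 hp, pow_add]
    by_cases h : Odd p.1
    · rw [h.neg_one_pow]
      ring
    · simp [creationExponent, h]
  have h : euler (P * Q) = 0 := by
    rw [euler_mul, hneg, euler_formalExp_creationExponent]
    ring
  have h' := congrArg (PowerSeries.coeff n) h
  rw [coeff_euler, map_zero, smul_eq_zero_iff_right hn.ne', PowerSeries.coeff_mul] at h'
  simpa [hP, creationCoeff_natCast, mul_assoc] using h'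

/-- This is `nsmul_creationCoeff` at `n - k`: the extra terms contain a `creationCoeff` of negative
index. -/
theorem sum_creationExponent_mul_creationCoeff (n k : ℕ) :
    ∑ p ∈ antidiagonal n,
      (p.1 • PowerSeries.coeff p.1 creationExponent) * creationCoeff (p.2 - k) =
        ((n : ℤ) - k) • creationCoeff (n - k) := by
  induction k generalizing n with
  | zero =>
    simp only [Nat.cast_zero, sub_zero]
    rw [← nsmul_creationCoeff, natCast_zsmul]
  | succ k ih =>
    have h0 : creationCoeff (0 - ((k + 1 : ℕ) : ℤ)) = 0 := creationCoeff_of_neg (by omega)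
    cases n with
    | zero =>
      rw [Nat.cast_zero, h0]
      simp [creationExponent]
    | succ n =>
      rw [Finset.Nat.sum_antidiagonal_succ']
      simp only [Nat.cast_zero, h0, mul_zero, zero_add]
      have h (a : ℕ) : ((a + 1 : ℕ) : ℤ) - ((k + 1 : ℕ) : ℤ) = a - k := by push_cast; ring
      simp only [h, ih]

theorem annihilationExponent_creationExponent {k : ℕ} (hk : Odd k) (j : ℕ) :
    k • PowerSeries.coeff k annihilationExponent
      (j • PowerSeries.coeff j creationExponent) =
        if j = k then -2 * (k : OddPowerSumRing) else 0 := by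
  by_cases hj : Odd j
  swap
  · rw [if_neg (by rintro rfl; exact hj hk)]
    simp [creationExponent, hj]
  have hG : j • PowerSeries.coeff j creationExponent = 2 * MvPolynomial.X ⟨j, hj⟩ := by
    have : (j : ℂ) ≠ 0 := Nat.cast_ne_zero.2 hj.pos.ne'
    rw [creationExponent, PowerSeries.coeff_mk, dif_pos hj, nsmul_eq_mul, ← mul_assoc,
      ← map_natCast (MvPolynomial.C (R := ℂ) (σ := {n : ℕ // Odd n})), ← map_mul,
      mul_div_cancel₀ _ this, map_ofNat]
  have hX : MvPolynomial.pderiv (R := ℂ) (⟨k, hk⟩ : {n : ℕ // Odd n})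
      (MvPolynomial.X ⟨j, hj⟩) = if j = k then 1 else 0 := by
    simp [MvPolynomial.pderiv_X, Pi.single_apply]
  have h2 : (2 : OddPowerSumRing) * MvPolynomial.X ⟨j, hj⟩ =
      2 • MvPolynomial.X ⟨j, hj⟩ := by simp
  rw [hG, h2, map_nsmul, annihilationExponent, PowerSeries.coeff_mk, dif_pos hk,
    LinearMap.neg_apply]
  simp only [Derivation.coeFn_coe, hX]
  split_ifs
  · simp
    ring
  · simp

/-- `∂ q_n / ∂ p_k = (2 / k) q_{n-k}` for odd `k`. -/
theorem nsmul_annihilationExponent_creationCoeff (k : ℕ) (n : ℤ) :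
    k • PowerSeries.coeff k annihilationExponent (creationCoeff n) =
      if Odd k then -2 * creationCoeff (n - k) else 0 := by
  split_ifs with hk
  swap
  · simp [annihilationExponent, hk]
  rcases lt_or_ge n 0 with hn | hn
  · rw [creationCoeff_of_neg hn, creationCoeff_of_neg (by omega)]
    simp
  lift n to ℕ using hn
  induction n using Nat.strong_induction_on with
  | _ n ih =>
  rcases Nat.eq_zero_or_pos n with rfl | hn
  · have h1 : PowerSeries.coeff k annihilationExponent (1 : OddPowerSumRing) = 0 := by
      simp [annihilationExponent, hk]
    rw [Nat.cast_zero, creationCoeff_zero, h1, creationCoeff_of_neg (by have := hk.pos; omega)]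
    simp
  refine (smul_right_injective _ hn.ne') ?_
  simp only
  -- The derivation is applied to the recursion for `n • creationCoeff n`: it hits the exponent only
  -- at `p.1 = k`, and the other factor is known by induction.
  have hterm : ∀ p ∈ antidiagonal n, k • PowerSeries.coeff k annihilationExponent
      ((p.1 • PowerSeries.coeff p.1 creationExponent) * creationCoeff p.2) =
      (if p.1 = k then -2 * (k : OddPowerSumRing) * creationCoeff (n - k) else 0) +
        -2 * ((p.1 • PowerSeries.coeff p.1 creationExponent) * creationCoeff (p.2 - k)) := by
    intro p hp
    have hp' := mem_antidiagonal.1 hp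
    rw [annihilationExponent_mul, smul_add, ← smul_mul_assoc,
      annihilationExponent_creationExponent hk, ← mul_smul_comm, ite_mul, zero_mul]
    congr 1
    · refine if_ctx_congr Iff.rfl (fun h => ?_) fun _ => rfl
      rw [show (n : ℤ) - k = p.2 by omega]
    · rcases Nat.eq_zero_or_pos p.1 with h0 | h0
      · simp [h0]
      · rw [ih p.2 (by omega)]
        ring
  have hsum : (∑ p ∈ antidiagonal n,
      if p.1 = k then -2 * (k : OddPowerSumRing) * creationCoeff (n - k) else 0) =
      -2 * (k : OddPowerSumRing) * creationCoeff (n - k) := by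
    rcases lt_or_ge n k with h | h
    · rw [creationCoeff_of_neg (by omega)]
      simp
    · rw [Finset.sum_eq_single (k, n - k)]
      · simp
      · intro p hp hne
        have hp' := mem_antidiagonal.1 hp
        refine if_neg fun hpk => hne (Prod.ext hpk ?_)
        simp only
        omega
      · intro hne
        exact absurd (mem_antidiagonal.2 (by simp only; omega)) hne
  rw [smul_comm, ← map_nsmul, nsmul_creationCoeff, map_sum, Finset.smul_sum,
    Finset.sum_congr rfl hterm, Finset.sum_add_distrib, hsum, ← Finset.mul_sum,
    sum_creationExponent_mul_creationCoeff, zsmul_eq_mul, nsmul_eq_mul]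
  push_cast
  ring

/-- The coefficients of `(1 - x) / (1 + x)`. -/
def contractionCoeff (n : ℕ) : ℤ := if n = 0 then 1 else 2 * (-1) ^ n

/-- For `c = (1 - x) / (1 + x)` one has `x c' = -2 (x + x^3 + x^5 + ⋯) c`. -/
theorem contractionCoeff_recursion (n : ℕ) :
    n * contractionCoeff n =
      ∑ p ∈ antidiagonal n, if Odd p.1 then -2 * contractionCoeff p.2 else 0 := by
  induction n using Nat.twoStepInduction with
  | zero => simp
  | one => simp [Finset.Nat.antidiagonal_succ, contractionCoeff]
  | more n h1 h2 =>
    have hodd (a : ℕ) : Odd (a + 1 + 1) ↔ Odd a := by simp [Nat.odd_add_one]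
    -- Splitting off `p.1 = 0` and `p.1 = 1` shifts `p.1` by two, which keeps its parity and leaves
    -- the sum for `n`.
    rw [Finset.Nat.sum_antidiagonal_succ, Finset.Nat.sum_antidiagonal_succ]
    simp only [hodd, ← h1]
    cases n with
    | zero => simp [contractionCoeff]
    | succ n =>
      simp [contractionCoeff, pow_succ]
      ring

/-- The factor is `exp (-∑ (2 / r) x ^ r)` over odd `r`, that is `(1 - x) / (1 + x)`; both sides
satisfy the same recursion in `b`. -/
theorem annihilationCoeff_creationCoeff (b : ℕ) (n : ℤ) :
    annihilationCoeff b (creationCoeff n) = contractionCoeff b • creationCoeff (n - b) := by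
  induction b using Nat.strong_induction_on with
  | _ b ih =>
  rcases Nat.eq_zero_or_pos b with rfl | hb
  · simp [annihilationCoeff_zero, contractionCoeff]
  refine (smul_right_injective _ hb.ne') ?_
  simp only
  rw [nsmul_annihilationCoeff, ← Nat.cast_smul_eq_nsmul ℤ b (_ • _), smul_smul,
    contractionCoeff_recursion, Finset.sum_smul]
  refine Finset.sum_congr rfl fun p hp => ?_
  have hp' := Finset.HasAntidiagonal.mem_antidiagonal.1 hp
  rcases Nat.eq_zero_or_pos p.1 with h0 | h0
  · simp [h0]
  rw [ih p.2 (by omega), map_zsmul, smul_comm, nsmul_annihilationExponent_creationCoeff,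
    show n - (p.2 : ℤ) - p.1 = n - b by omega]
  split_ifs
  · rw [mul_smul, smul_comm]
    simp
  · simp

/-! ### The anticommutation of the operators `Y` -/

theorem sum_range_antidiagonal {M : Type*} [AddCommMonoid M] {I N : ℕ} {g : ℕ → ℕ → M}
    (h : ∀ i e, I ≤ i ∨ N ≤ e → g i e = 0) :
    ∑ b ∈ Finset.range (I + N), ∑ p ∈ antidiagonal b, g p.1 p.2 =
      ∑ i ∈ Finset.range I, ∑ e ∈ Finset.range N, g i e := by
  rw [← Finset.sum_product', ← Finset.sum_fiberwise_of_maps_to 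
    (s := Finset.range I ×ˢ Finset.range N) (t := Finset.range (I + N)) (g := fun p => p.1 + p.2)]
  · refine Finset.sum_congr rfl fun b _ => (Finset.sum_subset ?_ ?_).symm
    · intro p hp
      exact mem_antidiagonal.2 (Finset.mem_filter.1 hp).2
    · intro p hp hp'
      have := mem_antidiagonal.1 hp
      refine h _ _ ?_
      by_contra! hc
      exact hp' (by simp [hc, this])
  · intro p hp
    simp only [Finset.mem_product, Finset.mem_range] at hp ⊢
    omega

/-- The coefficients of the normally ordered product of two operators `Y`. -/
noncomputable def contraction (m n : ℕ) : OddPowerSumRing :=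
  ∑ i ∈ Finset.range (n + 1),
    creationCoeff (m + i : ℕ) * (contractionCoeff i • creationCoeff ((n : ℤ) - i))

theorem contraction_eq_sum_range {m n I : ℕ} (h : n < I) :
    contraction m n = ∑ i ∈ Finset.range I,
      creationCoeff (m + i : ℕ) * (contractionCoeff i • creationCoeff ((n : ℤ) - i)) := by
  refine Finset.sum_subset (Finset.range_subset_range.2 h) fun i _ hi => ?_
  have : n + 1 ≤ i := by simpa using hi
  rw [creationCoeff_of_neg (a := n - i) (by omega), smul_zero, mul_zero]

theorem contraction_eq (m n : ℕ) :
    contraction m n = 2 * ∑ i ∈ Finset.range n, (-1) ^ (i + 1) *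
      (creationCoeff (m + (i + 1) : ℕ) * creationCoeff ((n : ℤ) - (i + 1 : ℕ))) +
        creationCoeff m * creationCoeff n := by
  rw [contraction, Finset.sum_range_succ', Finset.mul_sum]
  congr 1
  · refine Finset.sum_congr rfl fun i _ => ?_
    rw [contractionCoeff, if_neg i.succ_ne_zero, zsmul_eq_mul]
    push_cast
    ring
  · simp [contractionCoeff]

/-- Splitting the coefficient of `t ^ (m + n)` in `Q(-t) Q(t)` at the index `m` gives the two
alternating sums and the middle term `q_m q_n`. The left-hand side is `2 (-1) ^ m` times this
coefficient. -/
theorem contraction_add_comm {m n : ℕ} (h : 0 < m + n) :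
    contraction m n + contraction n m = 0 := by
  have hQ := sum_neg_one_pow_creationCoeff h
  rw [Finset.Nat.sum_antidiagonal_eq_sum_range_succ_mk, Nat.succ_eq_add_one, add_assoc,
    Finset.sum_range_add, Finset.sum_range_succ', ← Finset.sum_range_reflect] at hQ
  have h1 : ∑ i ∈ Finset.range m, (-1 : OddPowerSumRing) ^ (m - 1 - i) *
      (creationCoeff (m - 1 - i : ℕ) * creationCoeff (m + n - (m - 1 - i) : ℕ)) =
      (-1) ^ m * ∑ i ∈ Finset.range m, (-1) ^ (i + 1) *
      (creationCoeff (n + (i + 1) : ℕ) * creationCoeff ((m : ℤ) - (i + 1 : ℕ))) := by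
    rw [Finset.mul_sum]
    refine Finset.sum_congr rfl fun i hi => ?_
    have hi' := Finset.mem_range.1 hi
    obtain ⟨j, rfl⟩ := Nat.exists_eq_add_of_lt hi'
    rw [show i + j + 1 - 1 - i = j by omega,
      show ((i + j + 1 : ℕ) : ℤ) - (i + 1 : ℕ) = (j : ℕ) by omega,
      show i + j + 1 + n - j = n + (i + 1) by omega, ← mul_assoc ((-1) ^ _) ((-1) ^ _), ← pow_add,
      show i + j + 1 + (i + 1) = j + 2 * (i + 1) by ring, pow_add _ j, pow_mul]
    ring
  have h2 : ∑ i ∈ Finset.range n, (-1 : OddPowerSumRing) ^ (m + (i + 1)) *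
      (creationCoeff (m + (i + 1) : ℕ) * creationCoeff (m + n - (m + (i + 1)) : ℕ)) =
      (-1) ^ m * ∑ i ∈ Finset.range n, (-1) ^ (i + 1) *
      (creationCoeff (m + (i + 1) : ℕ) * creationCoeff ((n : ℤ) - (i + 1 : ℕ))) := by
    rw [Finset.mul_sum]
    refine Finset.sum_congr rfl fun i hi => ?_
    have hi' := Finset.mem_range.1 hi
    rw [show ((n : ℤ) - (i + 1 : ℕ)) = (m + n - (m + (i + 1)) : ℕ) by omega]
    ring
  simp only [h1, h2] at hQ
  rw [add_zero, Nat.add_sub_cancel_left] at hQ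
  rw [contraction_eq, contraction_eq]
  have hm : ((-1 : OddPowerSumRing) ^ m) * (-1) ^ m = 1 := by
    rw [← mul_pow]
    simp
  linear_combination (2 * (-1 : OddPowerSumRing) ^ m) * hQ -
    2 * (∑ i ∈ Finset.range m, (-1) ^ (i + 1) *
      (creationCoeff (n + (i + 1) : ℕ) * creationCoeff ((m : ℤ) - (i + 1 : ℕ))) +
      ∑ i ∈ Finset.range n, (-1) ^ (i + 1) *
      (creationCoeff (m + (i + 1) : ℕ) * creationCoeff ((n : ℤ) - (i + 1 : ℕ))) +
      creationCoeff m * creationCoeff n) * hm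

theorem Y_neg_apply (a : ℕ) {f : OddPowerSumRing} {N : ℕ}
    (hN : ∀ b, N ≤ b → annihilationCoeff b f = 0) :
    Y (-a) f = ∑ b ∈ Finset.range N, creationCoeff (a + b : ℕ) * annihilationCoeff b f := by
  change ∑ᶠ b : ℕ, creationCoeff (b - -(a : ℤ)) * annihilationCoeff b f = _
  rw [finsum_eq_sum_of_support_subset (s := Finset.range N)]
  · refine Finset.sum_congr rfl fun b _ => ?_
    rw [show (b : ℤ) - -(a : ℤ) = (a + b : ℕ) by push_cast; ring]
  · intro b hb
    by_contra h
    exact hb (by simp [hN b (by simpa using h)])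

/-- The product of two operators `Y` in normally ordered form. -/
theorem Y_neg_Y_neg_apply (a c : ℕ) {f : OddPowerSumRing} {N : ℕ}
    (hN : ∀ b, N ≤ b → annihilationCoeff b f = 0) :
    Y (-a) (Y (-c) f) = ∑ e ∈ Finset.range N, ∑ d ∈ Finset.range N,
      contraction (a + e) (c + d) * annihilationCoeff e (annihilationCoeff d f) := by
  have hcomm (e d : ℕ) : annihilationCoeff e (annihilationCoeff d f) =
      annihilationCoeff d (annihilationCoeff e f) :=
    LinearMap.congr_fun (commute_annihilationCoeff e d) f
  have hD (b : ℕ) : annihilationCoeff b (Y (-c) f) =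
      ∑ p ∈ antidiagonal b, ∑ d ∈ Finset.range N,
        (contractionCoeff p.1 • creationCoeff (((c + d : ℕ) : ℤ) - p.1)) *
          annihilationCoeff p.2 (annihilationCoeff d f) := by
    rw [Y_neg_apply c hN, map_sum, Finset.sum_comm]
    refine Finset.sum_congr rfl fun d _ => ?_
    rw [annihilationCoeff_mul]
    simp only [annihilationCoeff_creationCoeff]
  -- Only `i < c + N` and `e < N` contribute: for larger `i` the index `c + d - i` is negative, and
  -- for larger `e` the operators commute and kill `f`.
  have hzero (i e : ℕ) (h : c + N ≤ i ∨ N ≤ e) : ∑ d ∈ Finset.range N,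
      (contractionCoeff i • creationCoeff (((c + d : ℕ) : ℤ) - i)) *
        annihilationCoeff e (annihilationCoeff d f) = 0 := by
    refine Finset.sum_eq_zero fun d hd => ?_
    have := Finset.mem_range.1 hd
    rcases h with h | h
    · rw [creationCoeff_of_neg (by omega), smul_zero, zero_mul]
    · rw [hcomm, hN e h, map_zero, mul_zero]
  have hM : ∀ b, c + N + N ≤ b → annihilationCoeff b (Y (-c) f) = 0 := by
    intro b hb
    rw [hD]
    refine Finset.sum_eq_zero fun p hp => hzero _ _ ?_
    have := mem_antidiagonal.1 hp
    omega
  rw [Y_neg_apply a hM]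
  have h1 : ∀ b ∈ Finset.range (c + N + N),
      creationCoeff (a + b : ℕ) * annihilationCoeff b (Y (-c) f) =
      ∑ p ∈ antidiagonal b, creationCoeff (a + (p.1 + p.2) : ℕ) * ∑ d ∈ Finset.range N,
        (contractionCoeff p.1 • creationCoeff (((c + d : ℕ) : ℤ) - p.1)) *
          annihilationCoeff p.2 (annihilationCoeff d f) := by
    intro b _
    rw [hD, Finset.mul_sum]
    exact Finset.sum_congr rfl fun p hp => by rw [mem_antidiagonal.1 hp]
  rw [Finset.sum_congr rfl h1, sum_range_antidiagonal (g := fun i e =>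
    creationCoeff (a + (i + e) : ℕ) * ∑ d ∈ Finset.range N,
      (contractionCoeff i • creationCoeff (((c + d : ℕ) : ℤ) - i)) *
        annihilationCoeff e (annihilationCoeff d f))
    fun i e h => by rw [hzero i e h, mul_zero], Finset.sum_comm]
  refine Finset.sum_congr rfl fun e _ => ?_
  simp only [Finset.mul_sum]
  rw [Finset.sum_comm]
  refine Finset.sum_congr rfl fun d hd => ?_
  have := Finset.mem_range.1 hd
  rw [contraction_eq_sum_range (show c + d < c + N by omega), Finset.sum_mul]
  refine Finset.sum_congr rfl fun i _ => ?_
  rw [show a + (i + e) = a + e + i by ring, mul_assoc]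

/-- The operators `Y_{-a}` with `a > 0` anticommute. -/
theorem Y_neg_anticomm {a c : ℤ} (ha : 0 < a) (hc : 0 < c) :
    Y (-a) * Y (-c) = (-1 : ℂ) • (Y (-c) * Y (-a)) := by
  lift a to ℕ using ha.le
  lift c to ℕ using hc.le
  refine LinearMap.ext fun f => ?_
  rw [LinearMap.smul_apply, neg_one_smul, ← add_eq_zero_iff_eq_neg]
  obtain ⟨N, hN⟩ := annihilationCoeff_eventually_zero f
  rw [Module.End.mul_apply, Module.End.mul_apply,
    Y_neg_Y_neg_apply a c hN, Y_neg_Y_neg_apply c a hN,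
    Finset.sum_comm (s := Finset.range N), ← Finset.sum_add_distrib]
  refine Finset.sum_eq_zero fun d _ => ?_
  rw [← Finset.sum_add_distrib]
  refine Finset.sum_eq_zero fun e _ => ?_
  have hcomm : annihilationCoeff e (annihilationCoeff d f) =
      annihilationCoeff d (annihilationCoeff e f) :=
    LinearMap.congr_fun (commute_annihilationCoeff e d) f
  -- The total index `a + c + d + e` is positive, as `contraction_add_comm` requires.
  rw [hcomm, ← add_mul, contraction_add_comm (by omega), zero_mul]

theorem Y_neg_mul_self {a : ℤ} (ha : 0 < a) : Y (-a) * Y (-a) = 0 :=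
  LinearMap.ext fun f => by
    have h := LinearMap.congr_fun (Y_neg_anticomm ha ha) f
    rw [LinearMap.smul_apply, neg_one_smul] at h
    exact self_eq_neg.1 h

/-! ### Moving a part through a product -/

theorem YNeg_cons (a : ℤ) (μ : List ℤ) : YNeg (a :: μ) = Y (-a) * YNeg μ := by
  simp [YNeg]

theorem YNeg_append (μ ν : List ℤ) : YNeg (μ ++ ν) = YNeg μ * YNeg ν := by
  simp [YNeg]

/-- A positive part passes the positive parts behind it at the cost of a sign each. -/
theorem YNeg_cons_append {a : ℤ} (ha : 0 < a) {μ : List ℤ} (hμ : ∀ b ∈ μ, 0 < b) (ν : List ℤ) :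
    YNeg (a :: (μ ++ ν)) = (-1 : ℂ) ^ μ.length • YNeg (μ ++ a :: ν) := by
  induction μ with
  | nil => simp
  | cons b μ ih =>
    rw [List.cons_append, List.cons_append, YNeg_cons, YNeg_cons b, ← mul_assoc,
      Y_neg_anticomm ha (hμ b List.mem_cons_self), smul_mul_assoc, mul_assoc, ← YNeg_cons,
      ih fun c hc => hμ c (List.mem_cons_of_mem b hc), YNeg_cons, List.length_cons, pow_succ,
      mul_smul_comm, smul_smul, mul_comm]

theorem YNeg_cons_eq_zero {a : ℤ} (ha : 0 < a) {μ : List ℤ} (hμ : ∀ b ∈ μ, 0 < b) (ν : List ℤ) :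
    YNeg (a :: (μ ++ a :: ν)) = 0 := by
  rw [YNeg_cons_append ha hμ, YNeg_append, YNeg_cons, YNeg_cons, ← mul_assoc (Y (-a)),
    Y_neg_mul_self ha, zero_mul, mul_zero, smul_zero]

end ShiftedCode

/-! ### Contents of words -/

namespace ShiftedCode

open Letter

/-- The displacement of a letter along the diagonals: `R` and `U` raise the content by one,
`L` lowers it by one. -/
def Letter.step : Letter → ℤ
  | R => 1
  | L => -1
  | U => 1

/-- The total diagonal displacement of a word. -/
def displacement (u : List Letter) : ℤ := (u.map Letter.step).sum

/-- The contents reached by the letters `U` of a word that starts at content `h`. The word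
`shiftedPath μ`, started at `0`, reaches the parts of `μ`, from the last to the first. -/
def contents : List Letter → ℤ → List ℤ
  | [], _ => []
  | R :: u, h => contents u (h + 1)
  | L :: u, h => contents u (h - 1)
  | U :: u, h => (h + 1) :: contents u (h + 1)

@[simp] theorem displacement_nil : displacement [] = 0 := rfl

@[simp] theorem displacement_append (u v : List Letter) :
    displacement (u ++ v) = displacement u + displacement v := by
  simp [displacement]

@[simp] theorem displacement_cons (a : Letter) (u : List Letter) :
    displacement (a :: u) = a.step + displacement u := by
  simp [displacement]

@[simp] theorem displacement_replicate (n : ℕ) (a : Letter) :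
    displacement (List.replicate n a) = n * a.step := by
  simp [displacement]

@[simp] theorem displacement_horizontal (d : ℤ) : displacement (horizontal d) = d := by
  unfold horizontal
  split_ifs with h
  · simp [Letter.step, h]
  · simp [Letter.step]; omega

theorem contents_append (u v : List Letter) (h : ℤ) :
    contents (u ++ v) h = contents u h ++ contents v (h + displacement u) := by
  induction u generalizing h with
  | nil => simp [contents]
  | cons a u ih =>
    cases a <;> simp [contents, ih, Letter.step] <;> congr 1 <;> ring

theorem contents_eq_nil {u : List Letter} (hu : U ∉ u) (h : ℤ) : contents u h = [] := by
  induction u generalizing h with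
  | nil => rfl
  | cons a u ih => cases a <;> simp_all [contents]

theorem notMem_horizontal (d : ℤ) : U ∉ horizontal d := by
  unfold horizontal
  split_ifs <;> simp [List.mem_replicate]

theorem contents_horizontal (d h : ℤ) : contents (horizontal d) h = [] :=
  contents_eq_nil (notMem_horizontal d) h

/-- The path ends at the content of its last `U`, the first part; the default `0` is the content of
the starting point. -/
theorem displacement_shiftedPath (μ : List ℤ) :
    displacement (shiftedPath μ) = μ.head?.getD 0 := by
  induction μ using shiftedPath.induct with
  | case1 => simp [shiftedPath]
  | case2 a => simp [shiftedPath, Letter.step]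
  | case3 a b r ih => simp [shiftedPath, Letter.step, ih]

theorem contents_shiftedPath (μ : List ℤ) : contents (shiftedPath μ) 0 = μ.reverse := by
  induction μ using shiftedPath.induct with
  | case1 => simp [shiftedPath, contents]
  | case2 a => simp [shiftedPath, contents, contents_append, contents_horizontal]
  | case3 a b r ih =>
    simp [shiftedPath, contents, contents_append, contents_horizontal, ih,
      displacement_shiftedPath]
    ring

/-! ### Contents as an invariant of cancellation -/

/-- From some point on, the initial segments of `w` have the contents `r`. -/
def HasContents (w : Stream' Letter) (r : List ℤ) : Prop :=
  ∃ N, ∀ n, N ≤ n → contents (w.take n) 0 = r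

theorem HasContents.unique {w : Stream' Letter} {r s : List ℤ} (hr : HasContents w r)
    (hs : HasContents w s) : r = s := by
  obtain ⟨M, hM⟩ := hr
  obtain ⟨N, hN⟩ := hs
  rw [← hM (max M N) (le_max_left _ _), hN (max M N) (le_max_right _ _)]

theorem take_append (u : List Letter) (x : Stream' Letter) (n : ℕ) :
    (u ++ₛ x).take (u.length + n) = u ++ x.take n := by
  induction u with
  | nil => simp
  | cons a u ih =>
    rw [List.length_cons, Nat.succ_add_eq_add_succ, Nat.add_succ, Stream'.cons_append_stream,
      Stream'.take_succ_cons, ih, List.cons_append]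

theorem hasContents_append_const (u : List Letter) :
    HasContents (u ++ₛ Stream'.const R) (contents u 0) := by
  refine ⟨u.length, fun n hn => ?_⟩
  obtain ⟨n, rfl⟩ := Nat.exists_eq_add_of_le hn
  have : U ∉ (Stream'.const R).take n := by
    have h : (Stream'.const R).take n = List.replicate n R := by
      induction n with
      | zero => rfl
      | succ n ih =>
        rw [Stream'.take_succ, show (Stream'.const R).head = R from rfl, Stream'.tail_const,
          ih (by omega), List.replicate_succ]
    simp [h, List.mem_replicate]
  rw [take_append, contents_append, contents_eq_nil this, List.append_nil]

theorem hasContents_shiftedCode (μ : List ℤ) : HasContents (shiftedCode μ) μ.reverse := by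
  rw [← contents_shiftedPath]
  exact hasContents_append_const _

/-- Such a `c` contributes no content and shifts no later one, so initial segments of matching
length have equal contents. It covers `LR` and `RL` at once. -/
theorem hasContents_cancel {u c : List Letter} {x : Stream' Letter} (hc : U ∉ c)
    (hd : displacement c = 0) (r : List ℤ) :
    HasContents ((u ++ c) ++ₛ x) r ↔ HasContents (u ++ₛ x) r := by
  have key (n : ℕ) : contents (((u ++ c) ++ₛ x).take ((u ++ c).length + n)) 0 =
      contents ((u ++ₛ x).take (u.length + n)) 0 := by
    rw [take_append, take_append, contents_append, contents_append, contents_append,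
      contents_eq_nil hc, displacement_append, hd, List.append_nil, add_zero]
  constructor
  · rintro ⟨N, hN⟩
    refine ⟨u.length + N, fun n hn => ?_⟩
    obtain ⟨n, rfl⟩ := Nat.exists_eq_add_of_le hn
    rw [add_assoc, ← key]
    exact hN _ (by omega)
  · rintro ⟨N, hN⟩
    refine ⟨(u ++ c).length + N, fun n hn => ?_⟩
    obtain ⟨n, rfl⟩ := Nat.exists_eq_add_of_le hn
    rw [add_assoc, key]
    exact hN _ (by omega)

theorem CancelEquiv.hasContents_iff {v w : Stream' Letter} (h : CancelEquiv v w) (r : List ℤ) :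
    HasContents v r ↔ HasContents w r := by
  induction h with
  | rel v w h =>
    obtain ⟨u, x, rfl | rfl, rfl⟩ := h <;>
      exact hasContents_cancel (by simp) (by simp [Letter.step]) r
  | refl => rfl
  | symm _ _ _ ih => exact ih.symm
  | trans _ _ _ _ _ ih₁ ih₂ => exact ih₁.trans ih₂

/-- A composition is determined by its shifted code. -/
theorem CancelEquiv.shiftedCode_inj {μ ν : List ℤ}
    (h : CancelEquiv (shiftedCode μ) (shiftedCode ν)) : μ = ν :=
  List.reverse_injective
    (((h.hasContents_iff _).1 (hasContents_shiftedCode μ)).unique (hasContents_shiftedCode ν))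

theorem CancelEquiv.append_left (u : List Letter) {v w : Stream' Letter} (h : CancelEquiv v w) :
    CancelEquiv (u ++ₛ v) (u ++ₛ w) := by
  induction h with
  | rel v w h =>
    obtain ⟨s, x, h, rfl⟩ := h
    refine .rel _ _ ⟨u ++ s, x, ?_, by rw [Stream'.append_append_stream]⟩
    rcases h with rfl | rfl <;> simp [Stream'.append_append_stream]
  | refl => exact .refl _
  | symm _ _ _ ih => exact .symm _ _ ih
  | trans _ _ _ _ _ ih₁ ih₂ => exact .trans _ _ _ ih₁ ih₂

/-! ### Reduction of words to shifted paths -/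

theorem horizontal_natCast (n : ℕ) : horizontal n = List.replicate n R := by
  simp [horizontal]

theorem horizontal_neg_natCast (n : ℕ) : horizontal (-n) = List.replicate n L := by
  rcases Nat.eq_zero_or_pos n with rfl | hn
  · simp [horizontal]
  · simp [horizontal, show n ≠ 0 by omega]

theorem horizontal_append_right (d : ℤ) (x : Stream' Letter) :
    CancelEquiv ((horizontal d ++ [R]) ++ₛ x) (horizontal (d + 1) ++ₛ x) := by
  rcases le_or_gt 0 d with hd | hd
  · lift d to ℕ using hd
    rw [← Nat.cast_succ, horizontal_natCast, horizontal_natCast, ← List.replicate_succ']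
    exact .refl _
  · obtain ⟨n, rfl⟩ : ∃ n : ℕ, d = -((n + 1 : ℕ) : ℤ) := ⟨(-d - 1).toNat, by omega⟩
    rw [show -((n + 1 : ℕ) : ℤ) + 1 = -(n : ℤ) by push_cast; ring, horizontal_neg_natCast,
      horizontal_neg_natCast, List.replicate_succ', List.append_assoc]
    exact .rel _ _ ⟨List.replicate n L, x, Or.inl rfl, rfl⟩

theorem horizontal_append_left (d : ℤ) (x : Stream' Letter) :
    CancelEquiv ((horizontal d ++ [L]) ++ₛ x) (horizontal (d - 1) ++ₛ x) := by
  rcases le_or_gt d 0 with hd | hd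
  · obtain ⟨n, rfl⟩ : ∃ n : ℕ, d = -(n : ℤ) := ⟨(-d).toNat, by omega⟩
    rw [show -(n : ℤ) - 1 = -((n + 1 : ℕ) : ℤ) by push_cast; ring, horizontal_neg_natCast,
      horizontal_neg_natCast, ← List.replicate_succ']
    exact .refl _
  · obtain ⟨n, rfl⟩ : ∃ n : ℕ, d = ((n + 1 : ℕ) : ℤ) := ⟨(d - 1).toNat, by omega⟩
    rw [Nat.cast_succ, add_sub_cancel_right, ← Nat.cast_succ, horizontal_natCast,
      horizontal_natCast, List.replicate_succ', List.append_assoc]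
    exact .rel _ _ ⟨List.replicate n R, x, Or.inr rfl, rfl⟩

/-- The tail absorbs every `R`, and each `L` cancels against an `R` of the tail. -/
theorem horizontal_append_const (d : ℤ) :
    CancelEquiv (horizontal d ++ₛ Stream'.const R) (Stream'.const R) := by
  have hR : [R] ++ₛ Stream'.const R = Stream'.const R := (Stream'.const_eq R).symm
  rcases le_or_gt 0 d with hd | hd
  · lift d to ℕ using hd
    rw [horizontal_natCast]
    induction d with
    | zero => exact .refl _
    | succ n ih => rwa [List.replicate_succ', Stream'.append_append_stream, hR]
  · obtain ⟨n, rfl⟩ : ∃ n : ℕ, d = -(n : ℤ) := ⟨(-d).toNat, by omega⟩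
    clear hd
    induction n with
    | zero => exact .refl _
    | succ n ih =>
      refine .trans _ _ _ ?_ ih
      have h := horizontal_append_right (-((n + 1 : ℕ) : ℤ)) (Stream'.const R)
      rw [Stream'.append_append_stream, hR] at h
      rwa [show -((n + 1 : ℕ) : ℤ) + 1 = -(n : ℤ) by push_cast; ring] at h

theorem shiftedPath_cons (a : ℤ) (μ : List ℤ) :
    shiftedPath (a :: μ) = shiftedPath μ ++ horizontal (a - μ.head?.getD 0 - 1) ++ [U] := by
  cases μ <;> simp [shiftedPath]

/-- A word reduces to the path of its contents, followed by a horizontal displacement. -/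
theorem cancelEquiv_shiftedPath_append (u : List Letter) (x : Stream' Letter) :
    CancelEquiv (u ++ₛ x) ((shiftedPath (contents u 0).reverse ++
      horizontal (displacement u - (contents u 0).reverse.head?.getD 0)) ++ₛ x) := by
  induction u using List.reverseRecOn generalizing x with
  | nil => exact .refl _
  | append_singleton u a ih =>
    rw [Stream'.append_append_stream]
    refine .trans _ _ _ (ih _) ?_
    rw [contents_append, displacement_append]
    cases a with
    | R =>
      have h := (horizontal_append_right (displacement u - (contents u 0).reverse.head?.getD 0)
        x).append_left (shiftedPath (contents u 0).reverse)
      simp only [Stream'.append_append_stream] at h ⊢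
      simpa [contents, Letter.step, sub_add_eq_add_sub, CancelEquiv] using h
    | L =>
      have h := (horizontal_append_left (displacement u - (contents u 0).reverse.head?.getD 0)
        x).append_left (shiftedPath (contents u 0).reverse)
      simp only [Stream'.append_append_stream] at h ⊢
      simpa [contents, Letter.step, sub_right_comm, ← sub_eq_add_neg, CancelEquiv] using h
    | U =>
      have h : (contents u 0 ++ contents [U] (0 + displacement u)).reverse =
          (displacement u + 1) :: (contents u 0).reverse := by
        simp [contents]
      rw [h, shiftedPath_cons, ← Stream'.append_append_stream]
      simp only [List.head?_cons, Option.getD_some, displacement_cons, displacement_nil,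
        Letter.step, add_zero, sub_self]
      -- The new part is one more than the displacement, which offsets the `-1` in
      -- `shiftedPath_cons`: the horizontal remainder becomes the step to the new row.
      rw [show displacement u + 1 - (contents u 0).reverse.head?.getD 0 - 1 =
        displacement u - (contents u 0).reverse.head?.getD 0 by ring]
      simp only [show horizontal 0 = [] from rfl, List.append_nil]
      exact .refl _

theorem cancelEquiv_shiftedCode (u : List Letter) :
    CancelEquiv (u ++ₛ Stream'.const R) (shiftedCode (contents u 0).reverse) := by
  refine .trans _ _ _ (cancelEquiv_shiftedPath_append u _) ?_
  rw [Stream'.append_append_stream]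
  exact (horizontal_append_const _).append_left _

/-- Every finite word followed by the positive axis gives the shifted code of exactly one
composition, namely of its contents. -/
theorem cancelEquiv_shiftedCode_iff (u : List Letter) (ν : List ℤ) :
    CancelEquiv (shiftedCode ν) (u ++ₛ Stream'.const R) ↔ ν = (contents u 0).reverse := by
  constructor
  · exact fun h => CancelEquiv.shiftedCode_inj (.trans _ _ _ h (cancelEquiv_shiftedCode u))
  · rintro rfl
    exact .symm _ _ (cancelEquiv_shiftedCode u)

/-! ### Words in `R` and `U`, listed from right to left -/

/-- The contents of a word in the letters `R` and `U` that is listed from right to left. -/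
def heights : List Letter → List ℤ
  | [] => []
  | U :: b => ((b.length : ℤ) + 1) :: heights b
  | _ :: b => heights b

theorem heights_pos {b : List Letter} : ∀ a ∈ heights b, 0 < a := by
  induction b with
  | nil => simp [heights]
  | cons c b ih =>
    cases c <;> simp [heights] <;> exact ih

/-- In the reversed listing `c` is traversed before `b`, so its length is added to the heights of
`b`. -/
theorem heights_append (b c : List Letter) :
    heights (b ++ c) = (heights b).map (· + (c.length : ℤ)) ++ heights c := by
  induction b with
  | nil => simp [heights]
  | cons d b ih => cases d <;> simp [heights, ih]; ring

theorem length_heights (b : List Letter) : (heights b).length = b.count U := by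
  induction b with
  | nil => rfl
  | cons d b ih => cases d <;> simp [heights, ih]

theorem displacement_reverse_eq_length {b : List Letter} (hb : ∀ c ∈ b, c = R ∨ c = U) :
    displacement b.reverse = b.length := by
  induction b with
  | nil => rfl
  | cons d b ih =>
    have := ih fun c hc => hb c (List.mem_cons_of_mem d hc)
    rcases hb d List.mem_cons_self with rfl | rfl <;> simp [this, Letter.step]

theorem contents_reverse {b : List Letter} (hb : ∀ c ∈ b, c = R ∨ c = U) :
    contents b.reverse 0 = (heights b).reverse := by
  induction b with
  | nil => rfl
  | cons d b ih =>
    have hb' : ∀ c ∈ b, c = R ∨ c = U := fun c hc => hb c (List.mem_cons_of_mem d hc)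
    rcases hb d List.mem_cons_self with rfl | rfl <;>
      simp [contents_append, contents, heights, ih hb', displacement_reverse_eq_length hb']

/-- A finite beginning of a shifted code that ends with `U` lies inside the path. -/
theorem exists_shiftedPath_eq {μ : List ℤ} {u : List Letter} {γ : Stream' Letter}
    (h : shiftedCode μ = (u ++ [U]) ++ₛ γ) :
    ∃ g, shiftedPath μ = u ++ [U] ++ g ∧ γ = g ++ₛ Stream'.const R := by
  unfold shiftedCode at h
  generalize shiftedPath μ = p at h
  induction u generalizing p with
  | nil =>
    cases p with
    | nil => cases congrArg Stream'.head h
    | cons a p =>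
      obtain ⟨h1, h2⟩ := Stream'.cons_injective2 h
      exact ⟨p, by rw [h1]; rfl, h2.symm⟩
  | cons b u ih =>
    cases p with
    | nil =>
      -- The path is exhausted, so the letter `U` would lie in the tail `RRR⋯`; the induction
      -- hypothesis for the empty path excludes this.
      have h' : Stream'.const R = (u ++ [U]) ++ₛ γ := congrArg Stream'.tail h
      obtain ⟨g, hg, -⟩ := ih [] h'
      simp at hg
    | cons a p =>
      obtain ⟨h1, h2⟩ := Stream'.cons_injective2 h
      obtain ⟨g, hg, hγ⟩ := ih p h2
      exact ⟨g, by rw [h1, hg]; rfl, hγ⟩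

theorem set_of_getElem? {b : List Letter} {i : ℕ} {c : Letter} (h : b[i]? = some c) :
    b = b.take i ++ c :: b.drop (i + 1) ∧
      ∀ d, b.set i d = b.take i ++ d :: b.drop (i + 1) := by
  obtain ⟨hi, rfl⟩ := List.getElem?_eq_some_iff.1 h
  exact ⟨by simp, fun d => by rw [List.set_eq_take_append_cons_drop, if_pos hi]⟩

end ShiftedCode

/-! ### The main theorem -/

open ShiftedCode ShiftedCode.Letter

/-- `β` lists the letters `β₁, β₂, …, β_t` from right to left, so the letter `β_i` is `β[i - 1]`
and the word `β_t … β₂ β₁` is `β.reverse`. -/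
theorem theorem7p3 (m : ℤ) (μ : List ℤ) (hμ : μ.sum = m)
    (β : List Letter) (k : ℕ) (γ : Stream' Letter) (hk : 1 ≤ k)
    (hβ : ∀ b ∈ β, b = R ∨ b = U) (hβ₁ : β[0]? = some U)
    (hα : shiftedCode μ = (β.reverse ++ List.replicate k L ++ [U]) ++ₛ γ) :
    ((∀ a ∈ μ, 0 < a) → k ≤ β.length) ∧
    (β[k - 1]? = some U → YNeg μ = 0) ∧
    (β[k - 1]? = some R →
      ∃ ν : List ℤ,
        (∀ ν' : List ℤ,
          CancelEquiv (shiftedCode ν')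
            (((β.set (k - 1) U).reverse ++ List.replicate (k - 1) L) ++ₛ γ) ↔ ν' = ν) ∧
        ν.sum = m ∧
        ((∀ a ∈ μ, 0 ≤ a) → ∀ a ∈ ν, 0 ≤ a) ∧
        ((∀ a ∈ μ, 0 < a) → ∀ a ∈ ν, 0 < a) ∧
        YNeg μ = (-1 : ℂ) ^ ((β.take (k - 1)).count U) • YNeg ν) := by
  obtain ⟨i, rfl⟩ := Nat.exists_eq_add_of_le' hk
  rw [Nat.add_sub_cancel]
  obtain ⟨g, hg, rfl⟩ := exists_shiftedPath_eq hα
  set G := contents g ((β.length : ℤ) - i) with hG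
  -- With `k = i + 1`, the displayed `U` ends at content `t - k + 1 = t - i`; `G` collects the parts
  -- produced after it.
  have hμ' : μ = G.reverse ++ ((β.length : ℤ) - i) :: heights β := by
    have h := contents_shiftedPath μ
    rw [hg] at h
    simp only [contents_append, contents_reverse hβ, displacement_append,
      displacement_reverse_eq_length hβ, displacement_replicate] at h
    rw [contents_eq_nil (by simp [List.mem_replicate])] at h
    simp only [contents, displacement_cons, displacement_nil, Letter.step] at h
    have e1 : (0 : ℤ) + ((β.length : ℤ) + (i + 1 : ℕ) * -1) + 1 = β.length - i := by
      push_cast; ring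
    have e2 : (0 : ℤ) + ((β.length : ℤ) + (i + 1 : ℕ) * -1 + (1 + 0)) = β.length - i := by
      push_cast; ring
    rw [e1, e2, ← hG] at h
    rw [← List.reverse_reverse μ, ← h]
    simp
  refine ⟨fun h => ?_, fun h => ?_, fun h => ?_⟩
  · have := h ((β.length : ℤ) - i) (by rw [hμ']; simp)
    omega
  all_goals
    obtain ⟨hβ', hset⟩ := set_of_getElem? h
    set b := β.take i with hb
    set c := β.drop (i + 1) with hc
    have hi : i < β.length := (List.getElem?_eq_some_iff.1 h).1
    have hlen : (β.length : ℤ) - i = c.length + 1 := by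
      rw [hc, List.length_drop]
      omega
    -- These are the parts from `β_1, …, β_{k-1}`, the only ones that get crossed; positivity is
    -- automatic for them, and `G` may be arbitrary.
    have hpos : ∀ a ∈ (heights b).map (· + ((c.length : ℤ) + 1)), 0 < a := by
      intro a ha
      obtain ⟨a', ha', rfl⟩ := List.mem_map.1 ha
      have := heights_pos a' ha'
      omega
    rw [hlen] at hμ'
  -- The letter `β_k = U` has height `c.length + 1`, the value of the part in front.
  · rw [hμ', hβ', YNeg_append, heights_append]
    simp only [heights, List.length_cons, Nat.cast_succ]
    rw [YNeg_cons_eq_zero (by omega) hpos, mul_zero]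
  · have hR : ∀ d ∈ β.set i U, d = R ∨ d = U := by
      intro d hd
      rcases List.mem_or_eq_of_mem_set hd with hd | rfl
      · exact hβ d hd
      · exact Or.inr rfl
    have hμ'' : μ = G.reverse ++ ((c.length : ℤ) + 1) ::
        ((heights b).map (· + ((c.length : ℤ) + 1)) ++ heights c) := by
      rw [hμ', hβ', heights_append]
      simp [heights]
    have hν : (contents ((β.set i U).reverse ++ List.replicate i L ++ g) 0).reverse =
        G.reverse ++ ((heights b).map (· + ((c.length : ℤ) + 1)) ++
          ((c.length : ℤ) + 1) :: heights c) := by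
      -- The word before `g` has lost one `L` and the `U`, so `g` still starts at content `t - i`
      -- and yields the same `G`.
      have e : (0 : ℤ) + ((β.length : ℤ) + i * -1) = β.length - i := by ring
      rw [contents_append, contents_append, contents_reverse hR,
        contents_eq_nil (by simp [List.mem_replicate]), displacement_append,
        displacement_reverse_eq_length hR, displacement_replicate, List.length_set, Letter.step, e,
        ← hG, hset, heights_append]
      simp [heights]
    set ν := G.reverse ++ ((heights b).map (· + ((c.length : ℤ) + 1)) ++
      ((c.length : ℤ) + 1) :: heights c)
    have hperm : ν.Perm μ := by
      rw [hμ'']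
      exact List.perm_middle.append_left _
    refine ⟨ν, fun ν' => ?_, hperm.sum_eq.trans hμ, fun h a ha => h a (hperm.mem_iff.1 ha),
      fun h a ha => h a (hperm.mem_iff.1 ha), ?_⟩
    · rw [← Stream'.append_append_stream, cancelEquiv_shiftedCode_iff, hν]
    · rw [hμ'', YNeg_append, YNeg_cons_append (by omega) hpos, mul_smul_comm, ← YNeg_append,
        List.length_map, length_heights]
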